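/- For $\nu>-1$ and $z>0$ let $I_\nu(z)=\sum_{n\ge 0}\frac{(z/2)^{\nu+2n}}{n!\,\Gamma(n+\nu+1)}$ be the modified Bessel function of the first kind. Let $\mu$ be a $\sigma$-finite positive measure on $\mathbb{R}$, not concentrated on a single point, with $L(\theta)=\int e^{\theta u}\,\mu(du)<\infty$ for all $\theta$ in a non-empty open interval $(C,D)$, $-\infty\le C<D\le\infty$. The exponential family generated by $\mu$ on $(C,D)$ is the set of probability laws $P_\theta(du)=L(\theta)^{-1}e^{\theta u}\mu(du)$, $\theta\in(C,D)$; it is called natural when $(C,D)$ is the interior of $\{\theta: L(\theta)<\infty\}$. Its domain of means is $\{\int u\,P_\theta(du):\theta\in(C,D)\}$, and its variance function $V$ assigns to each $m$ in this domain the variance of the member of the family with mean $m$. Theorem. Let $\lambda>0$ and $\varepsilon>0$. There is a natural exponential family with domain of means $(0,\infty)$ and variance function $$V(m)=\frac{m^2}{\lambda}\sqrt{1+\varepsilon m^2},\qquad m>0.$$ Every exponential family with this domain of means and this variance function consists exactly of the laws $$W(m,du)=\left(\frac{1+\sqrt{1+\varepsilon m^2}}{\sqrt{\varepsilon}\,m}\right)^{\lambda}\frac{\lambda}{u}\,I_\lambda\!\left(\lambda\sqrt{\varepsilon}\,u\right)\exp\left(-\frac{\lambda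 u\sqrt{1+\varepsilon m^2}}{m}\right)1_{(0,\infty)}(u)\,du,\qquad m>0.$$ For every $m>0$, $W(m,du)$ is a probability law with mean $m$ and variance $V(m)$; it is absolutely continuous with respect to Lebesgue measure and infinitely divisible. -/

import Mathlib

open MeasureTheory ProbabilityTheory
open scoped ENNReal

noncomputable section

namespace EpsGamma

/-- The modified Bessel function of the first kind
`I_ν(z) = ∑_{n ≥ 0} (z/2)^(ν+2n) / (n! Γ(n+ν+1))`, for real `ν > -1` and real `z > 0`. -/
def besselI (ν z : ℝ) : ℝ :=
  ∑' n : ℕ, (z / 2) ^ (ν + 2 * (n : ℝ)) / ((n.factorial : ℝ) * Real.Gamma ((n : ℝ) + ν + 1))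

/-- The real points of the open interval `(C, D)`, whose end points may be infinite. -/
def openInterval (C D : EReal) : Set ℝ :=
  {θ : ℝ | C < (θ : EReal) ∧ (θ : EReal) < D}

/-- `μ` is a (positive) `σ`-finite measure on `ℝ`, not concentrated on a single point
(in particular not zero), whose Laplace transform `L(θ) = ∫ exp(θ u) μ(du)` is finite on the
non-empty open interval `(C, D)`. -/
structure IsGenerator (μ : Measure ℝ) (C D : EReal) : Prop where
  sigmaFinite : SigmaFinite μ
  nondegenerate : ∀ c : ℝ, μ {c}ᶜ ≠ 0
  lt : C < D
  laplace_finite : openInterval C D ⊆ integrableExpSet id μ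

/-- The member `P_θ(du) = exp(θ u - κ(θ)) μ(du)`, `κ(θ) = log ∫ exp(θ u) μ(du)`, of the
exponential family generated by `μ`. -/
def member (μ : Measure ℝ) (θ : ℝ) : Measure ℝ :=
  μ.tilted (fun u => θ * u)

/-- The exponential family `{P_θ : θ ∈ (C, D)}` generated by `μ`. -/
def expFamily (μ : Measure ℝ) (C D : EReal) : Set (Measure ℝ) :=
  member μ '' openInterval C D

/-- The mean of a law on `ℝ`. -/
def mean (P : Measure ℝ) : ℝ := ∫ u, u ∂P

/-- The exponential family generated by `μ` on `(C, D)` has the set `M` as its domain of means and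
the variance function `V : M → ℝ`: the means of its members fill exactly `M`, and the member with
mean `m` has variance `V m`. -/
structure HasVarianceFunction (μ : Measure ℝ) (C D : EReal) (M : Set ℝ) (V : ℝ → ℝ) : Prop where
  means : mean '' expFamily μ C D = M
  variance_eq : ∀ P ∈ expFamily μ C D, variance id P = V (mean P)

/-- The `n`-fold convolution power of a measure on `ℝ`. -/
def convPow (ν : Measure ℝ) : ℕ → Measure ℝ
  | 0 => Measure.dirac 0
  | n + 1 => (convPow ν n).conv ν

/-- Infinite divisibility: for every `n ≥ 1` the law is the `n`-fold convolution power of some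
probability law. -/
def InfinitelyDivisible (P : Measure ℝ) : Prop :=
  ∀ n : ℕ, 1 ≤ n → ∃ ν : Measure ℝ, IsProbabilityMeasure ν ∧ convPow ν n = P

/-- The density of the `ε`-gamma law with parameters `lam`, `ε` and mean `m`. -/
def density (lam ε m : ℝ) : ℝ → ℝ :=
  Set.indicator (Set.Ioi (0 : ℝ)) fun u =>
    ((1 + √(1 + ε * m ^ 2)) / (√ε * m)) ^ lam * (lam / u) * besselI lam (lam * √ε * u) *
      Real.exp (-(lam * u * √(1 + ε * m ^ 2)) / m)

/-- The `ε`-gamma law: the measure on `ℝ` with the above Lebesgue density. -/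
def law (lam ε m : ℝ) : Measure ℝ :=
  volume.withDensity fun u => ENNReal.ofReal (density lam ε m u)

/-- The variance function `V(m) = (m² / lam) √(1 + ε m²)`. -/
def varFun (lam ε m : ℝ) : ℝ := m ^ 2 / lam * √(1 + ε * m ^ 2)

end EpsGamma

end

/-!
Write `a = lam * √ε`. The laws are exponential tilts of the measure with density `(lam / u)
I_lam(a u)` on `(0, ∞)`, so everything rests on the Laplace transform `f` of that measure, `f(p) =
(a / (p + √(p² - a²))) ^ lam` for `p > a` (`laplaceMoment_zero`).

To compute `f`, the Bessel series is integrated term by term, which expands `f`, `f'` and `f''` in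
powers of `1 / p`. Comparing coefficients gives `(p² - a²) f'' + p f' = lam² f`
(`laplaceMoment_ode`). Hence `(p² - a²) f' ² - lam² f ²` has zero derivative; it vanishes at
infinity, so `f' = -lam f / √(p² - a²)`, and this equation is integrated using the leading term of
the expansion at infinity.

The cumulant function `κ(θ) = log f(-θ)` thus has `κ'(θ) = lam / √(θ² - a²)` on `(-∞, -a)`. The
mean runs through `(0, ∞)`, the parameter of mean `m` is `-p` with `p = lam √(1 + ε m²) / m`
(`rate`), and `κ''` at that point is the required variance. Since `κ'` is unbounded at `-a`, the
natural parameter interval ends there. The law with parameter `lam` has a moment generating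
function which is a `lam`-th power of a function of `a` and `p`, whence infinite divisibility.

For uniqueness, the mean `κ'` of any family with this variance function `V` solves `κ'' = V(κ')`.
As `rate` is a primitive of `-1 / V`, the function `rate(κ'(θ)) + θ` is constant, so `κ` is the
cumulant function above up to a translation of `θ` and an additive constant (`member_eq_law`). The
members are then identified by their moment generating functions near `0`
(`ext_of_mgf_eventuallyEq`).
-/

namespace EpsGamma

open Filter Topology Set

/-! ### Termwise Laplace transform of the Bessel density -/

/-- The density `(lam / u) I_lam(a u)` on `(0, ∞)`, extended by zero. -/
noncomputable def besselDensity (lam a : ℝ) : ℝ → ℝ :=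
  indicator (Ioi 0) fun u => lam / u * besselI lam (a * u)

/-- The measure with density `(lam / u) I_lam(a u)` on `(0, ∞)`. -/
noncomputable def besselMeasure (lam a : ℝ) : Measure ℝ :=
  volume.withDensity fun u => ENNReal.ofReal (besselDensity lam a u)

/-- The `n`-th term of the expansion in powers of `1 / p` of
`∫ u ^ k exp (-p u) (lam / u) I_lam(a u) du`. -/
noncomputable def laplaceTerm (lam a : ℝ) (k : ℕ) (p : ℝ) (n : ℕ) : ℝ :=
  lam * (a / 2) ^ (lam + 2 * (n : ℝ)) / ((n.factorial : ℝ) * Real.Gamma ((n : ℝ) + lam + 1)) *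
    (Real.Gamma (lam + 2 * n + k) / p ^ (lam + 2 * n + k))

variable {lam a p : ℝ}

lemma besselI_nonneg {ν z : ℝ} (hν : 0 < ν) (hz : 0 ≤ z) : 0 ≤ besselI ν z := by
  refine tsum_nonneg fun n => ?_
  have := Real.Gamma_pos_of_pos (show 0 < (n : ℝ) + ν + 1 by positivity)
  positivity

lemma besselDensity_nonneg (hlam : 0 < lam) (ha : 0 < a) (u : ℝ) :
    0 ≤ besselDensity lam a u := by
  refine indicator_nonneg (fun u hu => ?_) u
  have hu : 0 < u := hu
  have := besselI_nonneg hlam (mul_pos ha hu).le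
  positivity

lemma laplaceTerm_pos (hlam : 0 < lam) (ha : 0 < a) (hp : 0 < p) (k n : ℕ) :
    0 < laplaceTerm lam a k p n := by
  have := Real.Gamma_pos_of_pos (show 0 < (n : ℝ) + lam + 1 by positivity)
  have := Real.Gamma_pos_of_pos (show 0 < lam + 2 * n + k by positivity)
  unfold laplaceTerm
  positivity

lemma laplaceTerm_add_one_left (hlam : 0 < lam) (hp : 0 < p) (k n : ℕ) :
    laplaceTerm lam a (k + 1) p n = (lam + 2 * n + k) / p * laplaceTerm lam a k p n := by
  have h : 0 < lam + 2 * n + k := by positivity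
  unfold laplaceTerm
  push_cast
  rw [← add_assoc, Real.Gamma_add_one h.ne', Real.rpow_add_one hp.ne']
  field_simp

lemma laplaceTerm_succ (hlam : 0 < lam) (ha : 0 < a) (hp : 0 < p) (k n : ℕ) :
    laplaceTerm lam a k p (n + 1) = laplaceTerm lam a k p n *
      ((a / 2) ^ 2 / p ^ 2 * ((lam + 2 * n + k) * (lam + 2 * n + k + 1) /
        ((n + 1) * (n + lam + 1)))) := by
  have h : 0 < lam + 2 * n + k := by positivity
  have h' : 0 < (n : ℝ) + lam + 1 := by positivity
  have hG := Real.Gamma_pos_of_pos h'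
  unfold laplaceTerm
  have e1 : lam + 2 * ((n + 1 : ℕ) : ℝ) + k = lam + 2 * n + k + (2 : ℕ) := by push_cast; ring
  have e2 : lam + 2 * ((n + 1 : ℕ) : ℝ) = lam + 2 * n + (2 : ℕ) := by push_cast; ring
  have e3 : ((n + 1 : ℕ) : ℝ) + lam + 1 = (n + lam + 1) + 1 := by push_cast; ring
  have e4 : Real.Gamma (lam + 2 * n + k + (2 : ℕ)) =
      (lam + 2 * n + k + 1) * ((lam + 2 * n + k) * Real.Gamma (lam + 2 * n + k)) := by
    rw [← Real.Gamma_add_one h.ne', ← Real.Gamma_add_one (by positivity)]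
    congr 1
    push_cast
    ring
  rw [e1, e4, e2, e3, Real.Gamma_add_one h'.ne', Real.rpow_add_natCast hp.ne',
    Real.rpow_add_natCast (by positivity), Nat.factorial_succ]
  push_cast
  field_simp

lemma summable_laplaceTerm (hlam : 0 < lam) (ha : 0 < a) (hp : a < p) (k : ℕ) :
    Summable (laplaceTerm lam a k p) := by
  have hp0 : 0 < p := ha.trans hp
  refine summable_of_ratio_test_tendsto_lt_one (l := (a / p) ^ 2) ?_
    (.of_forall fun n => (laplaceTerm_pos hlam ha hp0 k n).ne') ?_
  · rw [sq_lt_one_iff₀ (by positivity)]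
    exact (div_lt_one hp0).2 hp
  have hr (n : ℕ) : ‖laplaceTerm lam a k p (n + 1)‖ / ‖laplaceTerm lam a k p n‖ =
      (a / 2) ^ 2 / p ^ 2 * (((lam + k) * (1 / ((n : ℝ) + 1)) + 2 * (n / (n + 1))) *
        ((lam + k + 1) * (1 / ((n : ℝ) + (lam + 1))) + 2 * (n / (n + (lam + 1))))) := by
    have hT := laplaceTerm_pos hlam ha hp0 k n
    rw [Real.norm_of_nonneg (laplaceTerm_pos hlam ha hp0 k (n + 1)).le,
      Real.norm_of_nonneg hT.le, laplaceTerm_succ hlam ha hp0, mul_div_cancel_left₀ _ hT.ne']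
    field_simp
    ring
  simp_rw [hr]
  -- each factor of the ratio is `O(1 / n) + 2 n / (n + c)`, so the ratio tends to `a² / p²`
  have hz (c : ℝ) : Tendsto (fun n : ℕ => 1 / ((n : ℝ) + c)) atTop (𝓝 0) :=
    (tendsto_const_nhds.div_atTop
      (tendsto_atTop_add_const_right _ _ tendsto_natCast_atTop_atTop))
  convert! ((((hz 1).const_mul (lam + k)).add
    ((tendsto_natCast_div_add_atTop (1 : ℝ)).const_mul 2)).mul
      (((hz (lam + 1)).const_mul (lam + k + 1)).add
    ((tendsto_natCast_div_add_atTop (lam + 1)).const_mul 2))).const_mul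
      ((a / 2) ^ 2 / p ^ 2) using 2
  field_simp
  ring

/-- The `n`-th summand of `u ^ k exp (-p u) (lam / u) I_lam(a u)`, as a Gamma integrand. -/
lemma laplace_integrand_eq (ha : 0 < a) {u : ℝ} (hu : 0 < u) (k n : ℕ) :
    u ^ k * Real.exp (-(p * u)) * (lam / u * ((a * u / 2) ^ (lam + 2 * (n : ℝ)) /
      ((n.factorial : ℝ) * Real.Gamma ((n : ℝ) + lam + 1)))) =
    lam * (a / 2) ^ (lam + 2 * (n : ℝ)) / ((n.factorial : ℝ) * Real.Gamma ((n : ℝ) + lam + 1)) *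
      (u ^ (lam + 2 * n + k - 1) * Real.exp (-(p * u))) := by
  rw [show a * u / 2 = a / 2 * u by ring, Real.mul_rpow (by positivity) hu.le,
    Real.rpow_sub_one hu.ne', Real.rpow_add_natCast hu.ne']
  ring

/-- Termwise integration of the Bessel series against `u ^ k exp (-p u)`. -/
lemma hasSum_laplaceTerm (hlam : 0 < lam) (ha : 0 < a) (hp : a < p) (k : ℕ) :
    HasSum (laplaceTerm lam a k p)
      (∫ u, u ^ k * Real.exp (-(p * u)) * besselDensity lam a u) := by
  have hp0 : 0 < p := ha.trans hp
  let F : ℕ → ℝ → ℝ := fun n u => u ^ k * Real.exp (-(p * u)) *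
    (lam / u * ((a * u / 2) ^ (lam + 2 * (n : ℝ)) /
      ((n.factorial : ℝ) * Real.Gamma ((n : ℝ) + lam + 1))))
  have hF0 (n : ℕ) (u : ℝ) (hu : u ∈ Ioi (0 : ℝ)) : 0 ≤ F n u := by
    have hu : 0 < u := hu
    have := Real.Gamma_pos_of_pos (show 0 < (n : ℝ) + lam + 1 by positivity)
    simp only [F]
    positivity
  have hint (n : ℕ) : ∫ u in Ioi 0, F n u = laplaceTerm lam a k p n := by
    rw [setIntegral_congr_fun measurableSet_Ioi
      fun u hu => laplace_integrand_eq ha hu k n, integral_const_mul,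
      Real.integral_rpow_mul_exp_neg_mul_Ioi (by positivity) hp0, laplaceTerm,
      Real.div_rpow zero_le_one hp0.le, Real.one_rpow]
    ring
  have hnorm (n : ℕ) : ∫ u in Ioi 0, ‖F n u‖ = laplaceTerm lam a k p n := by
    rw [← hint n]
    exact setIntegral_congr_fun measurableSet_Ioi fun u hu => Real.norm_of_nonneg (hF0 n u hu)
  -- the integral of a non-integrable function is `0` by convention
  have hFi (n : ℕ) : Integrable (F n) (volume.restrict (Ioi 0)) := by
    by_contra h
    have h1 := hint n
    rw [integral_undef h] at h1
    exact (laplaceTerm_pos hlam ha hp0 k n).ne h1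
  have key := hasSum_integral_of_summable_integral_norm hFi
    (by simp_rw [hnorm]; exact summable_laplaceTerm hlam ha hp k)
  simp_rw [hint] at key
  convert! key using 1
  rw [← integral_indicator measurableSet_Ioi]
  congr 1 with u
  by_cases hu : u ∈ Ioi (0 : ℝ)
  · simp only [besselDensity, indicator_of_mem hu, F, besselI, tsum_mul_left]
  · simp [besselDensity, indicator_of_notMem hu]

/-- The Laplace transform of the measure with density `(lam / u) I_lam(a u)`, weighted by the
`k`-th power; for `k = 1, 2` these are the derivatives of the Laplace transform up to sign. -/
noncomputable def laplaceMoment (lam a : ℝ) (k : ℕ) (p : ℝ) : ℝ :=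
  ∫ u, u ^ k * Real.exp (-(p * u)) * besselDensity lam a u

lemma laplaceMoment_pos (hlam : 0 < lam) (ha : 0 < a) (hp : a < p) (k : ℕ) :
    0 < laplaceMoment lam a k p := by
  have h := hasSum_laplaceTerm hlam ha hp k
  rw [laplaceMoment, ← h.tsum_eq]
  exact h.summable.tsum_pos (fun n => (laplaceTerm_pos hlam ha (ha.trans hp) k n).le) 0
    (laplaceTerm_pos hlam ha (ha.trans hp) k 0)

/-- Integrability follows from the integral being nonzero, the integral of a non-integrable function
being `0` by convention. -/
lemma integrable_laplace (hlam : 0 < lam) (ha : 0 < a) (hp : a < p) :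
    Integrable fun u => Real.exp (-(p * u)) * besselDensity lam a u := by
  by_contra h
  have h1 := laplaceMoment_pos hlam ha hp 0
  simp only [laplaceMoment, pow_zero, one_mul] at h1
  rw [integral_undef h] at h1
  exact lt_irrefl _ h1

/-- Up to an exponential factor, the density is one of the integrable functions above. -/
lemma aemeasurable_besselDensity (hlam : 0 < lam) (ha : 0 < a) :
    AEMeasurable (besselDensity lam a) := by
  have h : AEMeasurable fun u => Real.exp ((a + 1) * u) *
      (Real.exp (-((a + 1) * u)) * besselDensity lam a u) := by
    have := (integrable_laplace hlam ha (lt_add_one a)).1.aemeasurable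
    fun_prop
  refine h.congr (.of_forall fun u => ?_)
  simp only [← mul_assoc, ← Real.exp_add]
  simp

/-- The second order equation `(p² - a²) f'' + p f' = lam² f` of the Laplace transform `f`. -/
lemma laplaceMoment_ode (hlam : 0 < lam) (ha : 0 < a) (hp : a < p) :
    (p ^ 2 - a ^ 2) * laplaceMoment lam a 2 p - p * laplaceMoment lam a 1 p =
      lam ^ 2 * laplaceMoment lam a 0 p := by
  have hp0 : 0 < p := ha.trans hp
  have h0 := hasSum_laplaceTerm hlam ha hp 0
  have h1 := hasSum_laplaceTerm hlam ha hp 1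
  have h2 := hasSum_laplaceTerm hlam ha hp 2
  have hS := ((h2.mul_left (p ^ 2)).sub (h1.mul_left p)).sub (h0.mul_left (lam ^ 2))
  have e1 (n : ℕ) : laplaceTerm lam a 1 p n = (lam + 2 * n) / p * laplaceTerm lam a 0 p n := by
    simpa using laplaceTerm_add_one_left (a := a) hlam hp0 0 n
  have e2 (n : ℕ) : laplaceTerm lam a 2 p n =
      (lam + 2 * n + 1) / p * ((lam + 2 * n) / p * laplaceTerm lam a 0 p n) := by
    simpa [e1] using laplaceTerm_add_one_left (a := a) hlam hp0 1 n
  rw [← hasSum_nat_add_iff' 1] at hS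
  -- the index shift by one turns the left-over terms into those of `a² f''`
  have hS' := hS.unique ((h2.mul_left (a ^ 2)).congr_fun ?_)
  · simp only [Finset.sum_range_one, e1, e2] at hS'
    simp only [laplaceMoment]
    have : p ^ 2 * ((lam + 2 * ((0 : ℕ) : ℝ) + 1) / p *
        ((lam + 2 * ((0 : ℕ) : ℝ)) / p * laplaceTerm lam a 0 p 0)) -
        p * ((lam + 2 * ((0 : ℕ) : ℝ)) / p * laplaceTerm lam a 0 p 0) -
        lam ^ 2 * laplaceTerm lam a 0 p 0 = 0 := by
      field_simp
      push_cast
      ring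
    linarith
  · intro n
    simp only [e1, e2, laplaceTerm_succ hlam ha hp0]
    push_cast
    field_simp
    ring

/-! ### The Laplace transform in closed form -/

lemma integral_besselMeasure (hlam : 0 < lam) (ha : 0 < a) (g : ℝ → ℝ) :
    ∫ u, g u ∂besselMeasure lam a = ∫ u, g u * besselDensity lam a u := by
  rw [besselMeasure, integral_withDensity_eq_integral_toReal_smul₀
    (aemeasurable_besselDensity hlam ha).ennreal_ofReal (by simp)]
  congr with u
  rw [ENNReal.toReal_ofReal (besselDensity_nonneg hlam ha u), smul_eq_mul, mul_comm]

lemma integral_pow_mul_exp_besselMeasure (hlam : 0 < lam) (ha : 0 < a) (k : ℕ) (t : ℝ) :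
    ∫ u, u ^ k * Real.exp (t * u) ∂besselMeasure lam a = laplaceMoment lam a k (-t) := by
  rw [integral_besselMeasure hlam ha, laplaceMoment]
  simp

lemma mgf_besselMeasure (hlam : 0 < lam) (ha : 0 < a) (t : ℝ) :
    mgf id (besselMeasure lam a) t = laplaceMoment lam a 0 (-t) := by
  simp [← integral_pow_mul_exp_besselMeasure hlam ha, mgf]

lemma Iio_subset_integrableExpSet (hlam : 0 < lam) (ha : 0 < a) :
    Iio (-a) ⊆ integrableExpSet id (besselMeasure lam a) := by
  intro t ht
  have ht : a < -t := lt_neg_of_lt_neg ht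
  -- otherwise the moment generating function would take the conventional value `0`
  by_contra h
  have h1 := laplaceMoment_pos hlam ha ht 0
  rw [← mgf_besselMeasure hlam ha, mgf_undef h] at h1
  exact lt_irrefl _ h1

lemma mem_interior_integrableExpSet (hlam : 0 < lam) (ha : 0 < a) {t : ℝ} (ht : t < -a) :
    t ∈ interior (integrableExpSet id (besselMeasure lam a)) :=
  interior_mono (Iio_subset_integrableExpSet hlam ha) (by simpa using ht)

lemma hasDerivAt_laplaceMoment (hlam : 0 < lam) (ha : 0 < a) (hp : a < p) (k : ℕ) :
    HasDerivAt (laplaceMoment lam a k) (-laplaceMoment lam a (k + 1) p) p := by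
  have h := hasDerivAt_integral_pow_mul_exp_real
    (mem_interior_integrableExpSet hlam ha (neg_lt_neg hp)) k
  simp only [id_eq, integral_pow_mul_exp_besselMeasure hlam ha, neg_neg] at h
  simpa [Function.comp_def] using h.scomp p (hasDerivAt_neg p)

/-- As `p → ∞`, the leading term of the expansion in powers of `1 / p` dominates. -/
lemma tendsto_rpow_mul_laplaceMoment (hlam : 0 < lam) (ha : 0 < a) (k : ℕ) :
    Tendsto (fun p => p ^ (lam + k) * laplaceMoment lam a k p) atTop
      (𝓝 (lam * (a / 2) ^ lam / Real.Gamma (lam + 1) * Real.Gamma (lam + k))) := by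
  have hq0 : 0 < a + 1 := by linarith
  have hf (p : ℝ) (hp : 0 < p) (n : ℕ) : p ^ (lam + k) * laplaceTerm lam a k p n =
      lam * (a / 2) ^ (lam + 2 * (n : ℝ)) /
        ((n.factorial : ℝ) * Real.Gamma ((n : ℝ) + lam + 1)) *
        Real.Gamma (lam + 2 * n + k) / p ^ (2 * n) := by
    have : p ^ (lam + 2 * n + k) = p ^ (lam + k) * p ^ (2 * n) := by
      rw [← Real.rpow_add_natCast hp.ne']
      congr 1
      push_cast
      ring
    rw [laplaceTerm, this]
    have := Real.rpow_pos_of_pos hp (lam + k)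
    field_simp
  have hlim := tendsto_tsum_of_dominated_convergence (𝓕 := atTop)
    (f := fun p n => p ^ (lam + k) * laplaceTerm lam a k p n)
    (g := fun n => if n = 0 then
      lam * (a / 2) ^ lam / Real.Gamma (lam + 1) * Real.Gamma (lam + k) else 0)
    (bound := fun n => (a + 1) ^ (lam + k) * laplaceTerm lam a k (a + 1) n)
    ((summable_laplaceTerm hlam ha (lt_add_one a) k).mul_left _) ?_ ?_
  · rw [tsum_ite_eq] at hlim
    refine hlim.congr' ?_
    filter_upwards [eventually_gt_atTop a] with p hp
    rw [tsum_mul_left, (hasSum_laplaceTerm hlam ha hp k).tsum_eq, laplaceMoment]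
  · intro n
    split_ifs with hn
    · subst hn
      refine tendsto_const_nhds.congr' ?_
      filter_upwards [eventually_gt_atTop 0] with p hp
      rw [hf p hp]
      simp
    · refine Tendsto.congr' (f₁ := fun p : ℝ => lam * (a / 2) ^ (lam + 2 * (n : ℝ)) /
        ((n.factorial : ℝ) * Real.Gamma ((n : ℝ) + lam + 1)) *
        Real.Gamma (lam + 2 * n + k) / p ^ (2 * n)) ?_ (tendsto_const_nhds.div_atTop
        (tendsto_pow_atTop (by omega)))
      filter_upwards [eventually_gt_atTop 0] with p hp
      rw [hf p hp]
  · filter_upwards [eventually_ge_atTop (a + 1)] with p hp n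
    have hp0 : 0 < p := hq0.trans_le hp
    have := laplaceTerm_pos hlam ha hp0 k n
    rw [Real.norm_of_nonneg (by positivity), hf p hp0, hf _ hq0]
    have := Real.Gamma_pos_of_pos (show 0 < (n : ℝ) + lam + 1 by positivity)
    have := Real.Gamma_pos_of_pos (show 0 < lam + 2 * n + k by positivity)
    gcongr

lemma sq_sub_sq_pos (ha : 0 < a) (hp : a < p) : 0 < p ^ 2 - a ^ 2 := by nlinarith

/-- The Laplace transform `f` satisfies `(p² - a²) f' ² = lam² f ²`: by the second order equation
the difference of the two sides is constant, and it vanishes at infinity. -/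
lemma laplaceMoment_energy (hlam : 0 < lam) (ha : 0 < a) (hp : a < p) :
    (p ^ 2 - a ^ 2) * laplaceMoment lam a 1 p ^ 2 = lam ^ 2 * laplaceMoment lam a 0 p ^ 2 := by
  set E : ℝ → ℝ := fun p =>
    (p ^ 2 - a ^ 2) * laplaceMoment lam a 1 p ^ 2 - lam ^ 2 * laplaceMoment lam a 0 p ^ 2
  have hE (q : ℝ) (hq : q ∈ Ioi a) : HasDerivAt E 0 q := by
    convert! ((((hasDerivAt_id q).pow 2).sub_const (a ^ 2)).mul
      ((hasDerivAt_laplaceMoment hlam ha hq 1).pow 2)).sub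
      (((hasDerivAt_laplaceMoment hlam ha hq 0).pow 2).const_mul (lam ^ 2)) using 1
    simp
    linear_combination (2 * laplaceMoment lam a 1 q) * laplaceMoment_ode hlam ha hq
  obtain ⟨c, hc⟩ := isOpen_Ioi.exists_is_const_of_deriv_eq_zero isPreconnected_Ioi
    (fun q hq => (hE q hq).differentiableAt.differentiableWithinAt)
    (fun q hq => (hE q hq).deriv)
  -- both `p f'` and `f` are `O(p ^ (-lam))`
  have hz := tendsto_rpow_neg_atTop hlam
  have l0 : Tendsto (laplaceMoment lam a 0) atTop (𝓝 0) := by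
    have := hz.mul (tendsto_rpow_mul_laplaceMoment hlam ha 0)
    rw [zero_mul] at this
    refine this.congr' ?_
    filter_upwards [eventually_gt_atTop 0] with q hq
    rw [← mul_assoc, ← Real.rpow_add hq]
    simp
  have l1 : Tendsto (fun q => q * laplaceMoment lam a 1 q) atTop (𝓝 0) := by
    have := hz.mul (tendsto_rpow_mul_laplaceMoment hlam ha 1)
    rw [zero_mul] at this
    refine this.congr' ?_
    filter_upwards [eventually_gt_atTop 0] with q hq
    rw [← mul_assoc, ← Real.rpow_add hq]
    simp
  have l2 : Tendsto (fun q : ℝ => 1 - a ^ 2 / q ^ 2) atTop (𝓝 (1 - 0)) :=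
    tendsto_const_nhds.sub (tendsto_const_nhds.div_atTop (tendsto_pow_atTop two_ne_zero))
  have hE0 : Tendsto E atTop (𝓝 0) := by
    have := (l2.mul (l1.pow 2)).sub ((l0.pow 2).const_mul (lam ^ 2))
    simp only [ne_eq, OfNat.ofNat_ne_zero, not_false_eq_true, zero_pow, mul_zero, sub_zero] at this
    refine this.congr' ?_
    filter_upwards [eventually_gt_atTop 0] with q hq
    simp only [E]
    field_simp
  have hc0 : c = 0 := by
    refine tendsto_nhds_unique (tendsto_const_nhds.congr' ?_) hE0
    filter_upwards [eventually_gt_atTop a] with q hq using (hc q hq).symm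
  have := hc p hp
  simp only [E] at this
  linarith

lemma laplaceMoment_one (hlam : 0 < lam) (ha : 0 < a) (hp : a < p) :
    laplaceMoment lam a 1 p = lam / √(p ^ 2 - a ^ 2) * laplaceMoment lam a 0 p := by
  have h := sq_sub_sq_pos ha hp
  have hs := Real.sqrt_pos.2 h
  have h0 := laplaceMoment_pos hlam ha hp 0
  have h1 := laplaceMoment_pos hlam ha hp 1
  refine (sq_eq_sq₀ h1.le (by positivity)).1 ?_
  rw [mul_pow, div_pow, Real.sq_sqrt h.le]
  have := laplaceMoment_energy hlam ha hp
  field_simp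
  linarith

lemma hasDerivAt_sqrt_sq_sub_sq (ha : 0 < a) (hp : a < p) :
    HasDerivAt (fun q => √(q ^ 2 - a ^ 2)) (p / √(p ^ 2 - a ^ 2)) p := by
  have h := sq_sub_sq_pos ha hp
  convert! (((hasDerivAt_id p).pow 2).sub_const (a ^ 2)).sqrt h.ne' using 1
  simp
  field_simp

/-- The Laplace transform of `(lam / u) I_lam(a u) du` on `(0, ∞)` in closed form. -/
lemma laplaceMoment_zero (hlam : 0 < lam) (ha : 0 < a) (hp : a < p) :
    laplaceMoment lam a 0 p = (a / (p + √(p ^ 2 - a ^ 2))) ^ lam := by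
  have hd (q : ℝ) (hq : q ∈ Ioi a) :
      HasDerivAt (fun q => laplaceMoment lam a 0 q * (q + √(q ^ 2 - a ^ 2)) ^ lam) 0 q := by
    have h := Real.sqrt_pos.2 (sq_sub_sq_pos ha hq)
    have hq0 : 0 < q := ha.trans hq
    have hs : 0 < q + √(q ^ 2 - a ^ 2) := by positivity
    convert! (hasDerivAt_laplaceMoment hlam ha hq 0).mul
      (((hasDerivAt_id q).add (hasDerivAt_sqrt_sq_sub_sq ha hq)).rpow_const
        (p := lam) (Or.inl hs.ne')) using 1
    simp only [zero_add, laplaceMoment_one hlam ha hq, id_eq, Pi.add_apply]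
    rw [Real.rpow_sub_one hs.ne']
    field_simp
    ring
  obtain ⟨c, hc⟩ := isOpen_Ioi.exists_is_const_of_deriv_eq_zero isPreconnected_Ioi
    (fun q hq => (hd q hq).differentiableAt.differentiableWithinAt)
    (fun q hq => (hd q hq).deriv)
  have l2 : Tendsto (fun q : ℝ => 1 - a ^ 2 / q ^ 2) atTop (𝓝 (1 - 0)) :=
    tendsto_const_nhds.sub (tendsto_const_nhds.div_atTop (tendsto_pow_atTop two_ne_zero))
  have l3 : Tendsto (fun q : ℝ => (1 + √(1 - a ^ 2 / q ^ 2)) ^ lam) atTop (𝓝 (2 ^ lam)) := by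
    convert! (tendsto_const_nhds.add l2.sqrt).rpow_const (p := lam) (Or.inr hlam.le) using 2
    norm_num
  have l4 := (tendsto_rpow_mul_laplaceMoment hlam ha 0).mul l3
  have hca : c = a ^ lam := by
    have e : lam * (a / 2) ^ lam / Real.Gamma (lam + 1) * Real.Gamma (lam + (0 : ℕ)) * 2 ^ lam
        = a ^ lam := by
      have := Real.Gamma_pos_of_pos hlam
      rw [Real.Gamma_add_one hlam.ne', Real.div_rpow ha.le zero_le_two]
      have : (0 : ℝ) < 2 ^ lam := by positivity
      simp only [Nat.cast_zero, add_zero]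
      field_simp
    rw [e] at l4
    refine tendsto_nhds_unique (tendsto_const_nhds.congr' ?_) l4
    filter_upwards [eventually_gt_atTop a] with q hq
    have hq0 : 0 < q := ha.trans hq
    rw [← hc q hq]
    have : q + √(q ^ 2 - a ^ 2) = q * (1 + √(1 - a ^ 2 / q ^ 2)) := by
      rw [show q ^ 2 - a ^ 2 = q ^ 2 * (1 - a ^ 2 / q ^ 2) by field_simp,
        Real.sqrt_mul (by positivity), Real.sqrt_sq hq0.le]
      ring
    rw [this, Real.mul_rpow hq0.le (by positivity)]
    simp only [Nat.cast_zero, add_zero]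
    ring
  have hp0 : 0 < p := ha.trans hp
  have hs : 0 < p + √(p ^ 2 - a ^ 2) := by positivity
  rw [Real.div_rpow ha.le hs.le, ← hca, ← hc p hp]
  field_simp

/-! ### Cumulants of the Bessel measure -/

lemma besselMeasure_ne_zero (hlam : 0 < lam) (ha : 0 < a) : besselMeasure lam a ≠ 0 := by
  intro h
  have := laplaceMoment_pos hlam ha (lt_add_one a) 0
  rw [← neg_neg (a + 1), ← mgf_besselMeasure hlam ha, h] at this
  simp at this

lemma deriv_cgf_besselMeasure (hlam : 0 < lam) (ha : 0 < a) {t : ℝ} (ht : t < -a) :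
    deriv (cgf id (besselMeasure lam a)) t = lam / √(t ^ 2 - a ^ 2) := by
  have ht' : a < -t := lt_neg_of_lt_neg ht
  have h := integral_pow_mul_exp_besselMeasure hlam ha 1 t
  simp only [pow_one] at h
  rw [deriv_cgf (mem_interior_integrableExpSet hlam ha ht), mgf_besselMeasure hlam ha]
  simp only [id_eq, h]
  rw [laplaceMoment_one hlam ha ht', neg_sq,
    mul_div_cancel_right₀ _ (laplaceMoment_pos hlam ha ht' 0).ne']

lemma iteratedDeriv_two_cgf_besselMeasure (hlam : 0 < lam) (ha : 0 < a) {t : ℝ} (ht : t < -a) :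
    iteratedDeriv 2 (cgf id (besselMeasure lam a)) t = lam * -t / √(t ^ 2 - a ^ 2) ^ 3 := by
  have ht' : a < -t := lt_neg_of_lt_neg ht
  have hpos := sq_sub_sq_pos ha ht'
  rw [neg_sq] at hpos
  rw [iteratedDeriv_succ, iteratedDeriv_one]
  have : deriv (cgf id (besselMeasure lam a)) =ᶠ[𝓝 t] fun s => lam / √(s ^ 2 - a ^ 2) := by
    filter_upwards [Iio_mem_nhds ht] with s hs using deriv_cgf_besselMeasure hlam ha hs
  rw [this.deriv_eq]
  have hs := Real.sqrt_pos.2 hpos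
  have hd := (hasDerivAt_const t lam).div
    ((((hasDerivAt_id t).pow 2).sub_const (a ^ 2)).sqrt hpos.ne') hs.ne'
  refine hd.deriv.trans ?_
  simp
  field_simp

/-- The mean of the tilted laws tends to infinity at `-a`, so the cumulant function cannot be
analytic there and `-a` is the right end point of the natural parameter interval. -/
lemma interior_integrableExpSet_besselMeasure (hlam : 0 < lam) (ha : 0 < a) :
    interior (integrableExpSet id (besselMeasure lam a)) = Iio (-a) := by
  refine Subset.antisymm (fun t ht => ?_) fun t ht => mem_interior_integrableExpSet hlam ha ht
  by_contra hta
  have hta : -a ≤ t := not_lt.1 hta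
  have hmem : -a ∈ interior (integrableExpSet id (besselMeasure lam a)) :=
    (convex_integrableExpSet.interior.ordConnected).out
      (mem_interior_integrableExpSet hlam ha (sub_one_lt (-a))) ht
      ⟨(sub_one_lt _).le, hta⟩
  have hcont : Tendsto (deriv (cgf id (besselMeasure lam a))) (𝓝[<] (-a))
      (𝓝 (deriv (cgf id (besselMeasure lam a)) (-a))) :=
    (analyticAt_cgf hmem).deriv.continuousAt.tendsto.mono_left nhdsWithin_le_nhds
  refine not_tendsto_nhds_of_tendsto_atTop ?_ _ hcont
  have h0 : Tendsto (fun t : ℝ => √(t ^ 2 - a ^ 2)) (𝓝[<] (-a)) (𝓝[>] 0) := by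
    refine tendsto_nhdsWithin_iff.2 ⟨?_, ?_⟩
    · have : ContinuousAt (fun t : ℝ => √(t ^ 2 - a ^ 2)) (-a) := by fun_prop
      simpa using this.tendsto.mono_left (nhdsWithin_le_nhds (s := Iio (-a)))
    · filter_upwards [self_mem_nhdsWithin] with t ht
      have := sq_sub_sq_pos ha (lt_neg_of_lt_neg ht)
      rw [neg_sq] at this
      exact Real.sqrt_pos.2 this
  refine ((tendsto_inv_nhdsGT_zero.comp h0).const_mul_atTop hlam).congr' ?_
  filter_upwards [self_mem_nhdsWithin] with t ht
  rw [deriv_cgf_besselMeasure hlam ha ht]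
  rfl

/-! ### The explicit laws as tilted Bessel measures -/

variable {ε m : ℝ}

/-- The rate `p` of the exponential factor `exp (-p u)` in the law with mean `m`: the inverse of
the mean map `p ↦ lam / √(p² - lam² ε)`. -/
noncomputable def rate (lam ε m : ℝ) : ℝ := lam * √(1 + ε * m ^ 2) / m

lemma rate_pos (hlam : 0 < lam) (hε : 0 < ε) (hm : 0 < m) : 0 < rate lam ε m := by
  unfold rate
  positivity

lemma rate_sq_sub (hε : 0 < ε) (hm : 0 < m) :
    rate lam ε m ^ 2 - (lam * √ε) ^ 2 = (lam / m) ^ 2 := by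
  rw [rate, div_pow, mul_pow, mul_pow, Real.sq_sqrt (by positivity), Real.sq_sqrt hε.le]
  field_simp
  ring

lemma sqrt_rate_sq_sub (hlam : 0 < lam) (hε : 0 < ε) (hm : 0 < m) :
    √(rate lam ε m ^ 2 - (lam * √ε) ^ 2) = lam / m := by
  rw [rate_sq_sub hε hm, Real.sqrt_sq (by positivity)]

lemma lt_rate (hlam : 0 < lam) (hε : 0 < ε) (hm : 0 < m) : lam * √ε < rate lam ε m := by
  refine lt_of_pow_lt_pow_left₀ 2 (rate_pos hlam hε hm).le (sub_pos.1 ?_)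
  rw [rate_sq_sub hε hm]
  positivity

lemma rate_mean (hlam : 0 < lam) (hε : 0 < ε) (hp : lam * √ε < p) :
    rate lam ε (lam / √(p ^ 2 - (lam * √ε) ^ 2)) = p := by
  have ha : 0 < lam * √ε := by positivity
  have h := sq_sub_sq_pos ha hp
  have hs := Real.sqrt_pos.2 h
  have hp0 : 0 < p := ha.trans hp
  have hs2 := Real.sq_sqrt h.le
  rw [mul_pow lam (√ε) 2, Real.sq_sqrt hε.le] at hs hs2 ⊢
  set s := √(p ^ 2 - lam ^ 2 * ε)
  have h1 : 1 + ε * (lam / s) ^ 2 = (p / s) ^ 2 := by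
    field_simp
    linear_combination hs2
  rw [rate, h1, Real.sqrt_sq (by positivity)]
  field_simp

/-- The law with mean `m` is the tilted Bessel measure with exponential factor
`exp (-rate lam ε m * u)`: its constant is the inverse of the Laplace transform. -/
lemma law_eq_member (hlam : 0 < lam) (hε : 0 < ε) (hm : 0 < m) :
    law lam ε m = member (besselMeasure lam (lam * √ε)) (-rate lam ε m) := by
  have ha : 0 < lam * √ε := by positivity
  have hI : ∫ u, Real.exp (-rate lam ε m * u) ∂besselMeasure lam (lam * √ε) =
      (√ε * m / (1 + √(1 + ε * m ^ 2))) ^ lam := by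
    have h := mgf_besselMeasure hlam ha (-rate lam ε m)
    simp only [mgf, id_eq] at h
    rw [h, neg_neg, laplaceMoment_zero hlam ha (lt_rate hlam hε hm), sqrt_rate_sq_sub hlam hε hm,
      rate]
    congr 1
    field_simp
    ring
  rw [member, Measure.tilted, hI, besselMeasure, ← withDensity_mul₀
    (aemeasurable_besselDensity hlam ha).ennreal_ofReal (by fun_prop), law]
  congr with u
  rw [Pi.mul_apply, ← ENNReal.ofReal_mul (besselDensity_nonneg hlam ha u)]
  congr 1
  by_cases hu : u ∈ Ioi (0 : ℝ)
  · rw [density, besselDensity, indicator_of_mem hu, indicator_of_mem hu, rate,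
      Real.div_rpow (by positivity) (by positivity), Real.div_rpow (by positivity) (by positivity),
      show -(lam * √(1 + ε * m ^ 2) / m) * u = -(lam * u * √(1 + ε * m ^ 2)) / m by ring]
    field_simp
  · rw [density, besselDensity, indicator_of_notMem hu, indicator_of_notMem hu, zero_mul]

lemma member_besselMeasure (hlam : 0 < lam) (hε : 0 < ε) {t : ℝ} (ht : t < -(lam * √ε)) :
    member (besselMeasure lam (lam * √ε)) t = law lam ε (lam / √(t ^ 2 - (lam * √ε) ^ 2)) := by
  have ht' : lam * √ε < -t := lt_neg_of_lt_neg ht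
  have h := Real.sqrt_pos.2 (sq_sub_sq_pos (by positivity) ht')
  have hr := rate_mean hlam hε ht'
  rw [neg_sq] at h hr
  rw [law_eq_member hlam hε (by positivity), hr, neg_neg]

/-! ### Members of an exponential family -/

lemma mgf_member (μ : Measure ℝ) (θ t : ℝ) :
    mgf id (member μ θ) t = mgf id μ (θ + t) / mgf id μ θ := by
  have h := integral_exp_tilted (μ := μ) (fun u => θ * u) (fun u => t * u)
  simp only [Pi.add_apply, ← add_mul] at h
  exact h

lemma isProbabilityMeasure_member {μ : Measure ℝ} (hμ : μ ≠ 0) {θ : ℝ}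
    (hθ : θ ∈ integrableExpSet id μ) : IsProbabilityMeasure (member μ θ) :=
  haveI : NeZero μ := ⟨hμ⟩
  isProbabilityMeasure_tilted hθ

lemma mean_member {μ : Measure ℝ} {θ : ℝ} (hθ : θ ∈ interior (integrableExpSet id μ)) :
    mean (member μ θ) = deriv (cgf id μ) θ :=
  integral_tilted_mul_self hθ

lemma variance_member {μ : Measure ℝ} {θ : ℝ} (hθ : θ ∈ interior (integrableExpSet id μ)) :
    variance id (member μ θ) = iteratedDeriv 2 (cgf id μ) θ :=
  variance_tilted_mul hθ

lemma zero_mem_interior_integrableExpSet_member {μ : Measure ℝ} (hμ : μ ≠ 0) {θ : ℝ}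
    (hθ : θ ∈ interior (integrableExpSet id μ)) :
    0 ∈ interior (integrableExpSet id (member μ θ)) := by
  have := isProbabilityMeasure_member hμ (interior_subset hθ)
  have hc : Tendsto (fun t => θ + t) (𝓝 0) (𝓝 θ) :=
    (continuous_const_add θ).tendsto' 0 θ (add_zero θ)
  rw [mem_interior_iff_mem_nhds]
  filter_upwards [hc (isOpen_interior.mem_nhds hθ)] with t ht
  refine mgf_pos_iff.1 ?_
  rw [mgf_member]
  exact div_pos (mgf_pos' hμ (interior_subset (s := integrableExpSet id μ) ht))
    (mgf_pos' hμ (interior_subset (s := integrableExpSet id μ) hθ))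

/-- Two probability laws whose moment generating functions are finite and agree near `0` are equal:
the complex moment generating functions agree on a strip around the imaginary axis by the identity
theorem, hence so do the characteristic functions. -/
lemma ext_of_mgf_eventuallyEq {P Q : Measure ℝ} [IsProbabilityMeasure P] [IsProbabilityMeasure Q]
    (hP : 0 ∈ interior (integrableExpSet id P)) (h : mgf id P =ᶠ[𝓝 0] mgf id Q) : P = Q := by
  have hQ : 0 ∈ interior (integrableExpSet id Q) := by
    rw [mem_interior_iff_mem_nhds] at hP ⊢
    filter_upwards [hP, h] with t htP ht
    exact mgf_pos_iff.1 (ht ▸ mgf_pos htP)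
  let S := interior (integrableExpSet id P) ∩ interior (integrableExpSet id Q)
  have hS : Convex ℝ S := convex_integrableExpSet.interior.inter convex_integrableExpSet.interior
  have heq : EqOn (complexMGF id P) (complexMGF id Q) {z | z.re ∈ S} := by
    refine AnalyticOnNhd.eqOn_of_preconnected_of_frequently_eq
      (analyticOnNhd_complexMGF.mono fun z hz => hz.1)
      (analyticOnNhd_complexMGF.mono fun z hz => hz.2)
      (hS.linear_preimage Complex.reLm).isPreconnected (z₀ := 0) ⟨hP, hQ⟩ ?_
    have hreal : ∃ᶠ x : ℝ in 𝓝[≠] 0, complexMGF id P x = complexMGF id Q x := by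
      refine Eventually.frequently ?_
      filter_upwards [nhdsWithin_le_nhds h] with x hx
      rw [complexMGF_ofReal, complexMGF_ofReal, hx]
    refine Tendsto.frequently ?_ hreal
    refine tendsto_nhdsWithin_iff.2 ⟨?_, ?_⟩
    · exact (Complex.continuous_ofReal.tendsto' 0 0 rfl).mono_left nhdsWithin_le_nhds
    · filter_upwards [self_mem_nhdsWithin] with x hx
      simpa using hx
  refine Measure.ext_of_charFun (funext fun t => ?_)
  rw [← complexMGF_id_mul_I, ← complexMGF_id_mul_I]
  exact heq (by simpa using ⟨hP, hQ⟩)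

/-! ### Moments and infinite divisibility of the explicit laws -/

lemma neg_rate_mem_interior (hlam : 0 < lam) (hε : 0 < ε) (hm : 0 < m) :
    -rate lam ε m ∈ interior (integrableExpSet id (besselMeasure lam (lam * √ε))) :=
  mem_interior_integrableExpSet hlam (by positivity) (neg_lt_neg (lt_rate hlam hε hm))

lemma isProbabilityMeasure_law (hlam : 0 < lam) (hε : 0 < ε) (hm : 0 < m) :
    IsProbabilityMeasure (law lam ε m) := by
  rw [law_eq_member hlam hε hm]
  exact isProbabilityMeasure_member (besselMeasure_ne_zero hlam (by positivity))
    (interior_subset (neg_rate_mem_interior hlam hε hm))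

lemma memLp_law (hlam : 0 < lam) (hε : 0 < ε) (hm : 0 < m) : MemLp id 2 (law lam ε m) := by
  rw [law_eq_member hlam hε hm]
  exact memLp_tilted_mul (neg_rate_mem_interior hlam hε hm) 2

lemma mean_law (hlam : 0 < lam) (hε : 0 < ε) (hm : 0 < m) : mean (law lam ε m) = m := by
  rw [law_eq_member hlam hε hm, mean_member (neg_rate_mem_interior hlam hε hm),
    deriv_cgf_besselMeasure hlam (by positivity) (neg_lt_neg (lt_rate hlam hε hm)), neg_sq,
    sqrt_rate_sq_sub hlam hε hm]
  field_simp

lemma variance_law (hlam : 0 < lam) (hε : 0 < ε) (hm : 0 < m) :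
    variance id (law lam ε m) = varFun lam ε m := by
  rw [law_eq_member hlam hε hm, variance_member (neg_rate_mem_interior hlam hε hm),
    iteratedDeriv_two_cgf_besselMeasure hlam (by positivity) (neg_lt_neg (lt_rate hlam hε hm)),
    neg_sq, sqrt_rate_sq_sub hlam hε hm, rate, varFun]
  field_simp

/-- Near `0` the moment generating function of the law is a power with exponent `lam` of a function
that depends only on `lam * √ε` and on the rate. -/
lemma mgf_law (hlam : 0 < lam) (hε : 0 < ε) (hm : 0 < m) {t : ℝ}
    (ht : t < rate lam ε m - lam * √ε) :
    mgf id (law lam ε m) t =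
      ((rate lam ε m + √(rate lam ε m ^ 2 - (lam * √ε) ^ 2)) /
        (rate lam ε m - t + √((rate lam ε m - t) ^ 2 - (lam * √ε) ^ 2))) ^ lam := by
  have ha : 0 < lam * √ε := by positivity
  have hr := lt_rate hlam hε hm
  have h1 : 0 < rate lam ε m - t := by linarith
  have h2 := rate_pos hlam hε hm
  rw [law_eq_member hlam hε hm, mgf_member, mgf_besselMeasure hlam ha, mgf_besselMeasure hlam ha,
    neg_neg, show -(-rate lam ε m + t) = rate lam ε m - t by ring,
    laplaceMoment_zero hlam ha (by linarith), laplaceMoment_zero hlam ha hr,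
    ← Real.div_rpow (by positivity) (by positivity)]
  congr 1
  field_simp

lemma mgf_conv (μ ν : Measure ℝ) [SFinite μ] [SFinite ν] (t : ℝ) :
    mgf id (μ.conv ν) t = mgf id μ t * mgf id ν t := by
  simp only [mgf, id_eq, Measure.conv]
  rw [integral_map (by fun_prop) (by fun_prop), ← integral_prod_mul]
  simp only [mul_add, Real.exp_add]

instance isProbabilityMeasure_convPow (ν : Measure ℝ) [IsProbabilityMeasure ν] (n : ℕ) :
    IsProbabilityMeasure (convPow ν n) := by
  induction n with
  | zero => exact Measure.dirac.isProbabilityMeasure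
  | succ n ih =>
    rw [convPow]
    infer_instance

lemma mgf_convPow (ν : Measure ℝ) [IsProbabilityMeasure ν] (n : ℕ) (t : ℝ) :
    mgf id (convPow ν n) t = mgf id ν t ^ n := by
  induction n with
  | zero => simp [convPow, mgf]
  | succ n ih => rw [convPow, mgf_conv, ih, pow_succ]

/-- The `n`-th convolution root is the law with parameters `lam / n`, `n² ε` and mean `m / n`, which
has the same Bessel argument and the same rate. -/
lemma infinitelyDivisible_law (hlam : 0 < lam) (hε : 0 < ε) (hm : 0 < m) :
    InfinitelyDivisible (law lam ε m) := by
  intro n hn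
  have hn0 : (0 : ℝ) < n := by exact_mod_cast hn
  have hl : 0 < lam / n := by positivity
  have he : 0 < n ^ 2 * ε := by positivity
  have hm' : 0 < m / n := by positivity
  have := isProbabilityMeasure_law hl he hm'
  have := isProbabilityMeasure_law hlam hε hm
  refine ⟨law (lam / n) (n ^ 2 * ε) (m / n), inferInstance, Eq.symm ?_⟩
  have ea : lam / n * √(n ^ 2 * ε) = lam * √ε := by
    rw [Real.sqrt_mul (by positivity), Real.sqrt_sq hn0.le]
    field_simp
  have er : rate (lam / n) (n ^ 2 * ε) (m / n) = rate lam ε m := by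
    rw [rate, rate, show (n : ℝ) ^ 2 * ε * (m / n) ^ 2 = ε * m ^ 2 by field_simp]
    field_simp
  refine ext_of_mgf_eventuallyEq ?_ ?_
  · rw [law_eq_member hlam hε hm]
    exact zero_mem_interior_integrableExpSet_member
      (besselMeasure_ne_zero hlam (by positivity)) (neg_rate_mem_interior hlam hε hm)
  · filter_upwards [Iio_mem_nhds (sub_pos.2 (lt_rate hlam hε hm))] with t ht
    have ht : t < rate lam ε m - lam * √ε := ht
    have ha : 0 < lam * √ε := by positivity
    have h1 : 0 < rate lam ε m - t := by linarith
    have h2 := rate_pos hlam hε hm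
    rw [mgf_convPow, mgf_law hlam hε hm ht, mgf_law hl he hm' (by rwa [ea, er]), ea, er,
      ← Real.rpow_mul_natCast (by positivity), div_mul_cancel₀ _ hn0.ne']

/-! ### Existence -/

lemma openInterval_bot_coe (d : ℝ) : openInterval ⊥ (d : EReal) = Iio d := by
  ext t
  simp [openInterval]

lemma isGenerator_besselMeasure (hlam : 0 < lam) {a : ℝ} (ha : 0 < a) :
    IsGenerator (besselMeasure lam a) ⊥ ((-a : ℝ) : EReal) where
  sigmaFinite := SigmaFinite.withDensity_ofReal _
  nondegenerate c hc := by
    have h0 : besselMeasure lam a {c} = 0 :=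
      withDensity_absolutelyContinuous _ _ (by simp)
    refine besselMeasure_ne_zero hlam ha (Measure.measure_univ_eq_zero.1 ?_)
    rw [← union_compl_self {c}]
    exact measure_union_null h0 hc
  lt := EReal.bot_lt_coe _
  laplace_finite := by
    rw [openInterval_bot_coe]
    exact Iio_subset_integrableExpSet hlam ha

lemma expFamily_besselMeasure (hlam : 0 < lam) (hε : 0 < ε) :
    expFamily (besselMeasure lam (lam * √ε)) ⊥ ((-(lam * √ε) : ℝ) : EReal) =
      law lam ε '' Ioi 0 := by
  rw [expFamily, openInterval_bot_coe]
  ext P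
  constructor
  · rintro ⟨t, ht, rfl⟩
    have h := Real.sqrt_pos.2 (sq_sub_sq_pos (by positivity) (lt_neg_of_lt_neg ht))
    rw [neg_sq] at h
    exact ⟨_, mem_Ioi.2 (div_pos hlam h), (member_besselMeasure hlam hε ht).symm⟩
  · rintro ⟨m, hm, rfl⟩
    exact ⟨_, neg_lt_neg (lt_rate hlam hε hm), (law_eq_member hlam hε hm).symm⟩

lemma hasVarianceFunction_besselMeasure (hlam : 0 < lam) (hε : 0 < ε) :
    HasVarianceFunction (besselMeasure lam (lam * √ε)) ⊥ ((-(lam * √ε) : ℝ) : EReal) (Ioi 0)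
      (varFun lam ε) where
  means := by
    rw [expFamily_besselMeasure hlam hε, image_image,
      image_congr (s := Ioi 0) fun m hm => mean_law hlam hε hm, image_id']
  variance_eq P hP := by
    rw [expFamily_besselMeasure hlam hε] at hP
    obtain ⟨m, hm, rfl⟩ := hP
    rw [variance_law hlam hε hm, mean_law hlam hε hm]

/-! ### Uniqueness -/

lemma isOpen_openInterval (C D : EReal) : IsOpen (openInterval C D) :=
  (isOpen_Ioo (a := C) (b := D)).preimage continuous_coe_real_ereal

lemma ordConnected_openInterval (C D : EReal) : (openInterval C D).OrdConnected :=
  ⟨fun _ hx _ hy _ hz => ⟨hx.1.trans_le (EReal.coe_le_coe_iff.2 hz.1),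
    (EReal.coe_le_coe_iff.2 hz.2).trans_lt hy.2⟩⟩

lemma IsGenerator.ne_zero {μ : Measure ℝ} {C D : EReal} (h : IsGenerator μ C D) : μ ≠ 0 := by
  rintro rfl
  exact h.nondegenerate 0 rfl

lemma IsGenerator.subset_interior {μ : Measure ℝ} {C D : EReal} (h : IsGenerator μ C D) :
    openInterval C D ⊆ interior (integrableExpSet id μ) :=
  interior_maximal h.laplace_finite (isOpen_openInterval C D)

/-- The rate is a primitive of `-1 / V`. -/
lemma hasDerivAt_rate (hlam : 0 < lam) (hε : 0 < ε) (hm : 0 < m) :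
    HasDerivAt (rate lam ε) (-(varFun lam ε m)⁻¹) m := by
  have h1 : 0 < 1 + ε * m ^ 2 := by positivity
  have hs := Real.sqrt_pos.2 h1
  have hd := ((((((hasDerivAt_id m).pow 2).const_mul ε).const_add 1).sqrt h1.ne').const_mul
    lam).div (hasDerivAt_id m) hm.ne'
  refine hd.congr_deriv ?_
  simp only [varFun, id_eq]
  have := Real.sq_sqrt h1.le
  simp
  field_simp
  rw [this]
  ring

variable {μ : Measure ℝ} {C D : EReal}

/-- The mean `κ'` solves `κ'' = V(κ')`, so that `rate ∘ κ'` has derivative `-1`. -/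
lemma exists_rate_deriv_cgf (hlam : 0 < lam) (hε : 0 < ε) (hμ : IsGenerator μ C D)
    (hV : HasVarianceFunction μ C D (Ioi 0) (varFun lam ε)) :
    ∃ c, ∀ θ ∈ openInterval C D,
      0 < deriv (cgf id μ) θ ∧ rate lam ε (deriv (cgf id μ) θ) = c - θ := by
  have hpos (θ : ℝ) (hθ : θ ∈ openInterval C D) : 0 < deriv (cgf id μ) θ := by
    rw [← mean_member (hμ.subset_interior hθ)]
    have : mean (member μ θ) ∈ mean '' expFamily μ C D :=
      mem_image_of_mem _ (mem_image_of_mem _ hθ)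
    rwa [hV.means] at this
  have hd (θ : ℝ) (hθ : θ ∈ openInterval C D) :
      HasDerivAt (fun θ => rate lam ε (deriv (cgf id μ) θ) + θ) 0 θ := by
    have hθ' := hμ.subset_interior hθ
    have h2 : HasDerivAt (deriv (cgf id μ)) (varFun lam ε (deriv (cgf id μ) θ)) θ := by
      have h := (analyticAt_cgf hθ').deriv.differentiableAt.hasDerivAt
      have hv := hV.variance_eq _ (mem_image_of_mem _ hθ)
      rw [variance_member hθ', mean_member hθ', iteratedDeriv_succ, iteratedDeriv_one] at hv
      rwa [hv] at h
    have hm := hpos θ hθ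
    have hvar : 0 < varFun lam ε (deriv (cgf id μ) θ) := by
      unfold varFun
      positivity
    convert! ((hasDerivAt_rate hlam hε hm).comp θ h2).add (hasDerivAt_id θ) using 1
    field_simp
    ring
  obtain ⟨c, hc⟩ := (isOpen_openInterval C D).exists_is_const_of_deriv_eq_zero
    (ordConnected_openInterval C D).isPreconnected
    (fun θ hθ => (hd θ hθ).differentiableAt.differentiableWithinAt)
    (fun θ hθ => (hd θ hθ).deriv)
  exact ⟨c, fun θ hθ => ⟨hpos θ hθ, by linarith [hc θ hθ]⟩⟩

/-- Every member of a family with variance function `varFun lam ε` on `(0, ∞)` is the explicit law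
with the same mean: up to a translation of the parameter and an additive constant, the cumulant
function is that of the Bessel measure. -/
lemma member_eq_law (hlam : 0 < lam) (hε : 0 < ε) (hμ : IsGenerator μ C D)
    (hV : HasVarianceFunction μ C D (Ioi 0) (varFun lam ε)) {θ : ℝ} (hθ : θ ∈ openInterval C D) :
    member μ θ = law lam ε (deriv (cgf id μ) θ) := by
  obtain ⟨c, hc⟩ := exists_rate_deriv_cgf hlam hε hμ hV
  have ha : 0 < lam * √ε := by positivity
  set ρ := besselMeasure lam (lam * √ε)
  have hρ0 : ρ ≠ 0 := besselMeasure_ne_zero hlam ha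
  have hlt (s : ℝ) (hs : s ∈ openInterval C D) : s - c < -(lam * √ε) := by
    have := lt_rate hlam hε (hc s hs).1
    rw [(hc s hs).2] at this
    linarith
  have hρ (s : ℝ) (hs : s ∈ openInterval C D) : s - c ∈ interior (integrableExpSet id ρ) :=
    mem_interior_integrableExpSet hlam ha (hlt s hs)
  have hd (s : ℝ) (hs : s ∈ openInterval C D) :
      HasDerivAt (fun s => cgf id μ s - cgf id ρ (s - c)) 0 s := by
    have h1 := (analyticAt_cgf (hμ.subset_interior hs)).differentiableAt.hasDerivAt
    have h2 := (analyticAt_cgf (hρ s hs)).differentiableAt.hasDerivAt.comp_sub_const s c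
    refine (h1.sub h2).congr_deriv ?_
    have hm := (hc s hs).1
    rw [deriv_cgf_besselMeasure hlam ha (hlt s hs), ← neg_sq, neg_sub, ← (hc s hs).2,
      sqrt_rate_sq_sub hlam hε hm]
    field_simp
    ring
  obtain ⟨b, hb⟩ := (isOpen_openInterval C D).exists_is_const_of_deriv_eq_zero
    (ordConnected_openInterval C D).isPreconnected
    (fun s hs => (hd s hs).differentiableAt.differentiableWithinAt)
    (fun s hs => (hd s hs).deriv)
  have hexp (s : ℝ) (hs : s ∈ openInterval C D) :
      mgf id μ s = Real.exp b * mgf id ρ (s - c) := by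
    have : NeZero μ := ⟨hμ.ne_zero⟩
    have : NeZero ρ := ⟨hρ0⟩
    rw [← exp_cgf (hμ.laplace_finite hs),
      ← exp_cgf (interior_subset (s := integrableExpSet id ρ) (hρ s hs)), ← Real.exp_add]
    congr 1
    linarith [hb s hs]
  rw [law_eq_member hlam hε (hc θ hθ).1, (hc θ hθ).2, neg_sub]
  have := isProbabilityMeasure_member hμ.ne_zero (hμ.laplace_finite hθ)
  have := isProbabilityMeasure_member hρ0 (interior_subset (hρ θ hθ))
  refine ext_of_mgf_eventuallyEq
    (zero_mem_interior_integrableExpSet_member hμ.ne_zero (hμ.subset_interior hθ)) ?_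
  have hc0 : Tendsto (fun t => θ + t) (𝓝 0) (𝓝 θ) :=
    (continuous_const_add θ).tendsto' 0 θ (add_zero θ)
  filter_upwards [hc0 ((isOpen_openInterval C D).mem_nhds hθ)] with t ht
  rw [mgf_member, mgf_member, hexp _ ht, hexp _ hθ, mul_div_mul_left _ _ (Real.exp_ne_zero b)]
  congr 2
  ring

lemma expFamily_eq_law_image (hlam : 0 < lam) (hε : 0 < ε) (hμ : IsGenerator μ C D)
    (hV : HasVarianceFunction μ C D (Ioi 0) (varFun lam ε)) :
    expFamily μ C D = law lam ε '' Ioi 0 := by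
  rw [← hV.means, expFamily, image_image, image_image]
  refine image_congr fun θ hθ => ?_
  rw [mean_member (hμ.subset_interior hθ), member_eq_law hlam hε hμ hV hθ]

end EpsGamma

theorem mainTheorem7 (lam ε : ℝ) (hlam : 0 < lam) (hε : 0 < ε) :
    -- a natural exponential family with this variance function on `(0, ∞)` exists
    (∃ (μ : Measure ℝ) (C D : EReal), EpsGamma.IsGenerator μ C D ∧
      EpsGamma.openInterval C D = interior (integrableExpSet id μ) ∧
      EpsGamma.HasVarianceFunction μ C D (Set.Ioi 0) (EpsGamma.varFun lam ε)) ∧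
    -- every exponential family with this variance function consists of the explicit laws
    (∀ (μ : Measure ℝ) (C D : EReal), EpsGamma.IsGenerator μ C D →
      EpsGamma.HasVarianceFunction μ C D (Set.Ioi 0) (EpsGamma.varFun lam ε) →
      EpsGamma.expFamily μ C D = EpsGamma.law lam ε '' Set.Ioi 0) ∧
    -- the explicit laws, indexed by their means, are absolutely continuous and infinitely divisible
    (∀ m : ℝ, 0 < m →
      IsProbabilityMeasure (EpsGamma.law lam ε m) ∧
      MemLp id 2 (EpsGamma.law lam ε m) ∧
      EpsGamma.mean (EpsGamma.law lam ε m) = m ∧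
      variance id (EpsGamma.law lam ε m) = EpsGamma.varFun lam ε m ∧
      EpsGamma.law lam ε m ≪ volume ∧
      EpsGamma.InfinitelyDivisible (EpsGamma.law lam ε m)) := by
  have ha : 0 < lam * √ε := by positivity
  refine ⟨⟨EpsGamma.besselMeasure lam (lam * √ε), ⊥, ((-(lam * √ε) : ℝ) : EReal),
    EpsGamma.isGenerator_besselMeasure hlam ha, ?_,
    EpsGamma.hasVarianceFunction_besselMeasure hlam hε⟩,
    fun μ C D hμ hV => EpsGamma.expFamily_eq_law_image hlam hε hμ hV,
    fun m hm => ⟨EpsGamma.isProbabilityMeasure_law hlam hε hm, EpsGamma.memLp_law hlam hε hm,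
      EpsGamma.mean_law hlam hε hm, EpsGamma.variance_law hlam hε hm,
      withDensity_absolutelyContinuous _ _, EpsGamma.infinitelyDivisible_law hlam hε hm⟩⟩
  rw [EpsGamma.openInterval_bot_coe, EpsGamma.interior_integrableExpSet_besselMeasure hlam ha]
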